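/- Let $\mathcal V$ be a finite set of agents, $\mathcal V_s\subseteq\mathcal V$ a (possibly empty) set of stubborn agents, $d$ a natural number, and $\mathcal O\subseteq\mathbb R^d$ a confidence set. A state is a family $\Xi=(\xi^i)_{i\in\mathcal V}$ of opinions $\xi^i\in\mathbb R^d$. Put $\mathcal N_i(\Xi)=\{j\in\mathcal V:\xi^j-\xi^i\in\mathcal O\}$ for $i\in\mathcal V\setminus\mathcal V_s$ and $\mathcal N_i(\Xi)=\{i\}$ for $i\in\mathcal V_s$. The SCOD dynamics (set-based Hegselmann–Krause dynamics) are $$\xi^i(t+1)=\frac1{|\mathcal N_i(\Xi(t))|}\sum_{j\in\mathcal N_i(\Xi(t))}\xi^j(t),\qquad i\in\mathcal V,\ t=0,1,2,\dots$$ An equilibrium is a state that is left unchanged by this update. A state $\Xi$ is clustered if for all $i,j\in\mathcal V$ either $\xi^i=\xi^j$ or $\xi^j-\xi^i\notin\mathcal O$. Assume that $0\in\mathcal O$ and $\mathcal O=-\mathcal O$, and let $\Xi(t)$ be a trajectory of the dynamics such that, for some $\xi^*\in\mathbb R^d$, $\xi^i(0)=\xi^*$ for all $i\in\mathcal V_s$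 (no condition if $\mathcal V_s=\emptyset$). Then: (A) $\Xi(0)$ is an equilibrium if and only if it is clustered. (B) Every opinion has a finite limit $\xi^i(\infty)=\lim_{t\to\infty}\xi^i(t)\in\mathbb R^d$, and $\xi^i(\infty)=\xi^j(\infty)$ whenever $i$ and $j$ trust each other infinitely often, that is, $\xi^j(t)-\xi^i(t)\in\mathcal O$ for infinitely many $t$. If, moreover, $\mathcal O\supseteq\{\xi:\|\xi\|<R\}$ for some $R>0$, then: (C) The limit state $\Xi(\infty)=(\xi^i(\infty))_{i\in\mathcal V}$ is an equilibrium and is clustered. (D) If $\mathcal V_s=\emptyset$, the dynamics terminate in finitely many steps: there is $T$ with $\Xi(t)=\Xi(T)$ for all $t\ge T$. If $\mathcal V_s\ne\emptyset$, then for each $i\in\mathcal V$ either $\xi^i(t)\to\xi^*$ as $t\to\infty$, or there is $T$ with $\xi^i(t)=\xi^i(T)$ for all $t\ge T$. -/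

import Mathlib

open Filter Topology

noncomputable section

namespace SCOD

/-- A system state: the opinion vector in `ℝ^d` of each agent (the rows of the opinion matrix). -/
abbrev State (V : Type*) (d : ℕ) := V → EuclideanSpace ℝ (Fin d)

/-- In the state `X`, the opinion of agent `j` is admissible for agent `i`:
`X j - X i` belongs to the confidence set `O`. -/
def Trusts {V : Type*} {d : ℕ} (O : Set (EuclideanSpace ℝ (Fin d)))
    (X : State V d) (i j : V) : Prop :=
  X j - X i ∈ O

open Classical in
/-- The set of neighbors of agent `i` in the state `X`, where `S` is the set of stubborn agents:
a stubborn agent has itself as its only neighbor, a regular agent has all agents it trusts. -/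
def neighbors {V : Type*} [Fintype V] {d : ℕ} (O : Set (EuclideanSpace ℝ (Fin d))) (S : Set V)
    (X : State V d) (i : V) : Finset V :=
  if i ∈ S then {i} else Finset.univ.filter (fun j => Trusts O X i j)

/-- One opinion update: every agent takes the average of the opinions of its neighbors. -/
def step {V : Type*} [Fintype V] {d : ℕ} (O : Set (EuclideanSpace ℝ (Fin d))) (S : Set V)
    (X : State V d) : State V d :=
  fun i => ((neighbors O S X i).card : ℝ)⁻¹ • ∑ j ∈ neighbors O S X i, X j

/-- `ξ` is a trajectory of the dynamics; `ξ t i` is the opinion of agent `i` at time `t`. -/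
def IsSolution {V : Type*} [Fintype V] {d : ℕ} (O : Set (EuclideanSpace ℝ (Fin d))) (S : Set V)
    (ξ : ℕ → State V d) : Prop :=
  ∀ t, ξ (t + 1) = step O S (ξ t)

/-- An equilibrium is a state that the update leaves unchanged. -/
def IsEquilibrium {V : Type*} [Fintype V] {d : ℕ} (O : Set (EuclideanSpace ℝ (Fin d)))
    (S : Set V) (X : State V d) : Prop :=
  step O S X = X

/-- A state is clustered if any two agents hold equal opinions or the first does not find the
opinion of the second admissible. -/
def IsClustered {V : Type*} {d : ℕ} (O : Set (EuclideanSpace ℝ (Fin d)))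
    (X : State V d) : Prop :=
  ∀ i j, X i = X j ∨ X j - X i ∉ O

end SCOD

end

/-
Agents linked by trust that recurs infinitely often form the components of a graph. From some time
on agents listen only within their component, so each component can be treated on its own, and each
linear functional of the opinions separately. In a component call a stubborn agent (or, if there is
none, any agent) the root. Let `M` be the maximal value at time `t` and `M - δ` the value of the
root. As long as nobody listens to a set containing the root, by symmetry of trust nobody in the set
listens to the outside, so the bound `M - δ` persists on the set; as soon as somebody does, the set
can be enlarged at the price of a constant factor in `δ`. Hence the maximum drops by a fixed
fraction of `δ`; as it converges, the root converges to the same limit. The minimum behaves in the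
same way, so the component reaches consensus. Applied to a constant trajectory, this shows that
equilibria are clustered.

If `O` is a neighborhood of `0`, then from some time on agents trust each other exactly if they have
the same limit. Regular agents whose limit is not shared by a stubborn agent then average over the
same set as soon as their limits agree, so they merge in one step and stop.
-/

namespace SCOD

theorem inv_card_mul_sum_le {ι : Type*} {s : Finset ι} {f : ι → ℝ} {M : ℝ} {j : ι} (hj : j ∈ s)
    (hf : ∀ i ∈ s, f i ≤ M) :
    (s.card : ℝ)⁻¹ * ∑ i ∈ s, f i ≤ M - (s.card : ℝ)⁻¹ * (M - f j) := by
  have hs : (s.card : ℝ) ≠ 0 := Nat.cast_ne_zero.2 (Finset.card_ne_zero_of_mem hj)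
  have hgap : M - f j ≤ ∑ i ∈ s, (M - f i) :=
    Finset.single_le_sum (f := fun i => M - f i) (fun i hi => sub_nonneg.2 (hf i hi)) hj
  rw [Finset.sum_sub_distrib, Finset.sum_const, nsmul_eq_mul] at hgap
  calc (s.card : ℝ)⁻¹ * ∑ i ∈ s, f i
      ≤ (s.card : ℝ)⁻¹ * (s.card * M - (M - f j)) := by gcongr; linarith
    _ = M - (s.card : ℝ)⁻¹ * (M - f j) := by rw [mul_sub, inv_mul_cancel_left₀ hs]

section Consensus

variable {V : Type*}

/-- The set `A` influences its complement: somebody outside `A` listens to somebody in `A`, where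
`r b a` means that `b` listens to `a`. -/
def Influences (r : V → V → Prop) (A : Set V) : Prop :=
  ∃ a ∈ A, ∃ b ∉ A, r b a

/-- A time-varying network, in which `r t i j` means that `i` listens to `j` at time `t`, such that
every set containing the root `i₀` influences its complement whenever it is influenced by it
(cut balance) and, unless it is everything, does so infinitely often. -/
structure IsRecurrentlyBalanced (r : ℕ → V → V → Prop) (i₀ : V) : Prop where
  refl : ∀ t i, r t i i
  influences_of_compl : ∀ t A, i₀ ∈ A → Influences (r t) Aᶜ → Influences (r t) A
  frequently_influences : ∀ A, i₀ ∈ A → A ≠ Set.univ → ∃ᶠ t in atTop, Influences (r t) A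

/-- Everybody's next value lies below every upper bound on the values it listens to, by at least the
fraction `η` of the gap between this bound and any one of these values. Averages with weights at
least `η` satisfy this for `u` and for `-u`. -/
def IsSubaveraging (η : ℝ) (r : ℕ → V → V → Prop) (u : ℕ → V → ℝ) : Prop :=
  ∀ t i j M, r t i j → (∀ k, r t i k → u t k ≤ M) → u (t + 1) i ≤ M - η * (M - u t j)

variable {η M δ : ℝ} {r : ℕ → V → V → Prop} {u : ℕ → V → ℝ} {i₀ : V} {A : Set V} {t : ℕ}

theorem IsSubaveraging.restrict (hu : IsSubaveraging η r u) {C : Set V}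
    (hC : ∀ t, ∀ i ∈ C, ∀ j, r t i j → j ∈ C) :
    IsSubaveraging η (fun t (i j : C) => r t i j) (fun t i => u t i) :=
  fun t i j M hij hM => hu t i j M hij fun k hk => hM ⟨k, hC t i i.2 k hk⟩ hk

theorem IsSubaveraging.le_of_not_influences_compl (hu : IsSubaveraging η r u) (hη : 0 ≤ η)
    (hr : ∀ t i, r t i i) (hA : ¬ Influences (r t) Aᶜ) (hM : ∀ i ∈ A, u t i ≤ M) :
    ∀ i ∈ A, u (t + 1) i ≤ M := by
  intro i hi
  have hclosed : ∀ j, r t i j → j ∈ A := fun j hij => by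
    by_contra hj
    exact hA ⟨j, hj, i, not_not_intro hi, hij⟩
  have hle := hu t i i M (hr t i) fun j hij => hM j (hclosed j hij)
  linarith [mul_nonneg hη (sub_nonneg.2 (hM i hi))]

theorem IsSubaveraging.le_succ (hu : IsSubaveraging η r u) (hη : 0 ≤ η) (hr : ∀ t i, r t i i)
    (hM : ∀ i, u t i ≤ M) (i : V) : u (t + 1) i ≤ M :=
  hu.le_of_not_influences_compl (A := Set.univ) hη hr (by simp [Influences]) (fun i _ => hM i) i
    trivial

theorem IsSubaveraging.exists_le_insert (hu : IsSubaveraging η r u) (hη : 0 ≤ η)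
    (hr : ∀ t i, r t i i) (hM : ∀ i, u t i ≤ M) (hA : ∀ i ∈ A, u t i ≤ M - δ)
    (hlink : Influences (r t) A) :
    ∃ b ∉ A, ∀ i ∈ insert b A, u (t + 1) i ≤ M - η * δ := by
  have hstep : ∀ i, ∀ j ∈ A, r t i j → u (t + 1) i ≤ M - η * δ := fun i j hj hij => by
    have hgap : η * δ ≤ η * (M - u t j) :=
      mul_le_mul_of_nonneg_left (by linarith [hA j hj]) hη
    linarith [hu t i j M hij fun k _ => hM k]
  obtain ⟨a, ha, b, hb, hba⟩ := hlink
  exact ⟨b, hb, Set.forall_mem_insert.2 ⟨hstep b a ha hba, fun i hi => hstep i i hi (hr t i)⟩⟩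

namespace IsRecurrentlyBalanced

theorem exists_le_insert_of_influences (h : IsRecurrentlyBalanced r i₀) (hu : IsSubaveraging η r u)
    (hη : 0 ≤ η) (hi₀ : i₀ ∈ A) {m : ℕ} (hlink : Influences (r (t + m)) A)
    (hM : ∀ i, u t i ≤ M) (hA : ∀ i ∈ A, u t i ≤ M - δ) :
    ∃ s, (∀ i, u s i ≤ M) ∧ ∃ b ∉ A, ∀ i ∈ insert b A, u s i ≤ M - η * δ := by
  induction m generalizing t with
  | zero => exact ⟨t + 1, hu.le_succ hη h.refl hM, hu.exists_le_insert hη h.refl hM hA hlink⟩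
  | succ m ih =>
    by_cases hnow : Influences (r t) A
    · exact ⟨t + 1, hu.le_succ hη h.refl hM, hu.exists_le_insert hη h.refl hM hA hnow⟩
    · exact ih (by rwa [Nat.add_right_comm]) (hu.le_succ hη h.refl hM)
        (hu.le_of_not_influences_compl hη h.refl (mt (h.influences_of_compl t A hi₀) hnow) hA)

variable [Finite V]

theorem exists_set_le (h : IsRecurrentlyBalanced r i₀) (hu : IsSubaveraging η r u) (hη : 0 ≤ η)
    (hη₁ : η ≤ 1) (hM : ∀ i, u t i ≤ M) {k : ℕ} (hk : k ≤ Nat.card V) :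
    ∃ s, (∀ i, u s i ≤ M) ∧
      ∃ A : Set V, i₀ ∈ A ∧ k ≤ A.ncard ∧ ∀ i ∈ A, u s i ≤ M - η ^ k * (M - u t i₀) := by
  induction k with
  | zero => exact ⟨t, hM, {i₀}, rfl, Nat.zero_le _, by simp⟩
  | succ k ih =>
    obtain ⟨s, hMs, A, hi₀, hkA, hA⟩ := ih (by omega)
    have hδ : 0 ≤ η ^ k * (M - u t i₀) := mul_nonneg (pow_nonneg hη k) (sub_nonneg.2 (hM i₀))
    rw [pow_succ', mul_assoc]
    by_cases hAV : A = Set.univ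
    · refine ⟨s, hMs, A, hi₀, by rwa [hAV, Set.ncard_univ], fun i hi => (hA i hi).trans ?_⟩
      linarith [mul_le_of_le_one_left hδ hη₁]
    · obtain ⟨s', hs', hlink⟩ := frequently_atTop.1 (h.frequently_influences A hi₀ hAV) s
      obtain ⟨m, rfl⟩ := Nat.exists_eq_add_of_le hs'
      obtain ⟨s', hMs', b, hb, hbA⟩ := h.exists_le_insert_of_influences hu hη hi₀ hlink hMs hA
      refine ⟨s', hMs', insert b A, Set.mem_insert_of_mem b hi₀, ?_, hbA⟩
      rw [Set.ncard_insert_of_notMem hb]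
      omega

theorem exists_forall_le (h : IsRecurrentlyBalanced r i₀) (hu : IsSubaveraging η r u)
    (hη : 0 ≤ η) (hη₁ : η ≤ 1) (hM : ∀ i, u t i ≤ M) :
    ∃ s, ∀ i, u s i ≤ M - η ^ Nat.card V * (M - u t i₀) := by
  obtain ⟨s, -, A, -, hcard, hA⟩ := h.exists_set_le hu hη hη₁ hM le_rfl
  obtain rfl : A = Set.univ :=
    (Set.eq_univ_iff_ncard A).2 ((Set.ncard_le_card A).antisymm hcard)
  exact ⟨s, fun i => hA i trivial⟩

theorem antitone_iSup (h : IsRecurrentlyBalanced r i₀) (hu : IsSubaveraging η r u) (hη : 0 ≤ η) :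
    Antitone fun t => ⨆ i, u t i :=
  have : Nonempty V := ⟨i₀⟩
  antitone_nat_of_succ_le fun t =>
    ciSup_le (hu.le_succ hη h.refl (le_ciSup (Finite.bddAbove_range (u t))))

theorem exists_tendsto_iSup (h : IsRecurrentlyBalanced r i₀) (hu : IsSubaveraging η r u)
    (hη : 0 < η) (hη₁ : η ≤ 1) (hbdd : BddBelow (Set.range fun t => u t i₀)) :
    ∃ L, Tendsto (fun t => ⨆ i, u t i) atTop (𝓝 L) ∧ Tendsto (fun t => u t i₀) atTop (𝓝 L) := by
  have : Nonempty V := ⟨i₀⟩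
  have hle : ∀ t i, u t i ≤ ⨆ i, u t i := fun t => le_ciSup (Finite.bddAbove_range (u t))
  have hbdd' : BddBelow (Set.range fun t => ⨆ i, u t i) := hbdd.range_mono _ fun t => hle t i₀
  have hsup := tendsto_atTop_ciInf (h.antitone_iSup hu hη.le) hbdd'
  set L := ⨅ t, ⨆ i, u t i
  set c := η ^ Nat.card V
  have hc : 0 < c := pow_pos hη _
  have hlower : ∀ t, (⨆ i, u t i) - ((⨆ i, u t i) - L) / c ≤ u t i₀ := fun t => by
    obtain ⟨s, hs⟩ := h.exists_forall_le hu hη.le hη₁ (hle t)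
    have hL : L ≤ (⨆ i, u t i) - c * ((⨆ i, u t i) - u t i₀) :=
      (ciInf_le hbdd' s).trans (ciSup_le hs)
    rw [sub_le_comm, le_div_iff₀' hc]
    linarith
  refine ⟨L, hsup, tendsto_of_tendsto_of_tendsto_of_le_of_le ?_ hsup hlower fun t => hle t i₀⟩
  simpa using hsup.sub ((hsup.sub_const L).div_const c)

theorem exists_tendsto (h : IsRecurrentlyBalanced r i₀) (hη : 0 < η) (hη₁ : η ≤ 1)
    (hu : IsSubaveraging η r u) (hu' : IsSubaveraging η r (-u)) :
    ∃ L, ∀ i, Tendsto (fun t => u t i) atTop (𝓝 L) := by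
  have hle : ∀ (v : ℕ → V → ℝ) t i, v t i ≤ ⨆ i, v t i :=
    fun v t => le_ciSup (Finite.bddAbove_range (v t))
  have hbdd : ∀ v, IsSubaveraging η r (-v) → BddBelow (Set.range fun t => v t i₀) := by
    intro v hv
    refine ⟨-⨆ i, (-v) 0 i, Set.forall_mem_range.2 fun t => neg_le.1 ?_⟩
    exact (hle (-v) t i₀).trans (h.antitone_iSup hv hη.le t.zero_le)
  obtain ⟨L, hsup, hL⟩ := h.exists_tendsto_iSup hu hη hη₁ (hbdd u hu')
  obtain ⟨L', hsup', hL'⟩ := h.exists_tendsto_iSup hu' hη hη₁ (hbdd (-u) (by rwa [neg_neg]))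
  obtain rfl : L' = -L := tendsto_nhds_unique hL' hL.neg
  refine ⟨L, fun i => tendsto_of_tendsto_of_tendsto_of_le_of_le ?_ hsup
    (fun t => neg_le.1 (hle (-u) t i)) fun t => hle u t i⟩
  simpa using hsup'.neg

end IsRecurrentlyBalanced

end Consensus

section Dynamics

variable {V : Type*} {d : ℕ} {O : Set (EuclideanSpace ℝ (Fin d))} {S : Set V}
  {X ξlim : State V d} {ξ : ℕ → State V d} {ξstar : EuclideanSpace ℝ (Fin d)} {i j : V}

theorem trusts_comm (hsymm : ∀ x, x ∈ O ↔ -x ∈ O) : Trusts O X i j ↔ Trusts O X j i := by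
  rw [Trusts, Trusts, hsymm, neg_sub]

theorem trusts_of_eq (hzero : 0 ∈ O) (hij : X i = X j) : Trusts O X i j := by
  simpa [Trusts, hij] using hzero

/-- The trust relation without the trust of stubborn agents in regular ones. Unlike in `neighbors`,
stubborn agents trusting each other are kept, which is harmless as long as all of them hold the same
opinion, and makes every one of them a possible root of its component. -/
def Listens (O : Set (EuclideanSpace ℝ (Fin d))) (S : Set V) (X : State V d) (i j : V) : Prop :=
  Trusts O X i j ∧ (i ∈ S → j ∈ S)

/-- The graph whose edges are the pairs of agents with infinitely recurring trust. -/
def recurrentGraph (O : Set (EuclideanSpace ℝ (Fin d))) (ξ : ℕ → State V d) : SimpleGraph V :=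
  SimpleGraph.fromRel fun i j => ∃ᶠ t in atTop, Trusts O (ξ t) i j

theorem connectedComponentMk_eq_of_frequently_trusts (hij : ∃ᶠ t in atTop, Trusts O (ξ t) i j) :
    (recurrentGraph O ξ).connectedComponentMk i = (recurrentGraph O ξ).connectedComponentMk j := by
  rcases eq_or_ne i j with rfl | hne
  · rfl
  · exact SimpleGraph.ConnectedComponent.sound
      (SimpleGraph.Adj.reachable ((SimpleGraph.fromRel_adj _ _ _).2 ⟨hne, .inl hij⟩))

theorem frequently_trusts_of_adj (hsymm : ∀ x, x ∈ O ↔ -x ∈ O)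
    (hij : (recurrentGraph O ξ).Adj i j) : ∃ᶠ t in atTop, Trusts O (ξ t) i j :=
  ((SimpleGraph.fromRel_adj _ _ _).1 hij).2.elim id fun hji =>
    hji.mono fun _ => (trusts_comm hsymm).1

theorem influences_listens_of_trusts (hzero : 0 ∈ O) (hsymm : ∀ x, x ∈ O ↔ -x ∈ O)
    (hstub : ∀ i ∈ S, X i = ξstar) {C : Set V} {i₀ a b : C}
    (hroot : ∀ i ∈ C, i ∈ S → (i₀ : V) ∈ S) {A : Set C} (hi₀ : i₀ ∈ A) (ha : a ∈ A) (hb : b ∉ A)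
    (hab : Trusts O X a b) : Influences (fun i j : C => Listens O S X i j) A := by
  by_cases hbS : (b : V) ∈ S
  · have hi₀S := hroot b b.2 hbS
    exact ⟨i₀, hi₀, b, hb, trusts_of_eq hzero ((hstub b hbS).trans (hstub i₀ hi₀S).symm),
      fun _ => hi₀S⟩
  · exact ⟨a, ha, b, hb, (trusts_comm hsymm).1 hab, fun h => absurd h hbS⟩

theorem isRecurrentlyBalanced_listens (hzero : 0 ∈ O) (hsymm : ∀ x, x ∈ O ↔ -x ∈ O)
    (hstub : ∀ t, ∀ i ∈ S, ξ t i = ξstar) {C : (recurrentGraph O ξ).ConnectedComponent} {i₀ : C}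
    (hroot : ∀ i ∈ C, i ∈ S → (i₀ : V) ∈ S) :
    IsRecurrentlyBalanced (fun t (i j : C) => Listens O S (ξ t) i j) i₀ where
  refl _ _ := ⟨trusts_of_eq hzero rfl, id⟩
  influences_of_compl t A hi₀ := by
    rintro ⟨b, hb, a, ha, hab⟩
    exact influences_listens_of_trusts hzero hsymm (hstub t) hroot hi₀ (not_not.1 ha) hb hab.1
  frequently_influences A hi₀ hA := by
    obtain ⟨c, hc⟩ := (Set.ne_univ_iff_exists_notMem A).1 hA
    obtain ⟨p⟩ := C.connected_toSimpleGraph.preconnected i₀ c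
    obtain ⟨⟨⟨a, b⟩, hadj⟩, -, ha, hb⟩ := p.exists_boundary_dart A hi₀ hc
    exact (frequently_trusts_of_adj hsymm hadj).mono fun t =>
      influences_listens_of_trusts hzero hsymm (hstub t) hroot hi₀ ha hb

/-- The limit state of a trajectory, in which agents that trust each other infinitely often
agree. -/
structure IsLimitState (O : Set (EuclideanSpace ℝ (Fin d))) (ξ : ℕ → State V d)
    (ξlim : State V d) : Prop where
  tendsto : ∀ i, Tendsto (fun t => ξ t i) atTop (𝓝 (ξlim i))
  eq_of_frequently_trusts : ∀ i j, (∃ᶠ t in atTop, Trusts O (ξ t) i j) → ξlim i = ξlim j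

theorem IsLimitState.of_add {T : ℕ} (h : IsLimitState O (fun t => ξ (t + T)) ξlim) :
    IsLimitState O ξ ξlim where
  tendsto i := (tendsto_add_atTop_iff_nat (f := fun t => ξ t i) T).1 (h.tendsto i)
  eq_of_frequently_trusts i j hij := h.eq_of_frequently_trusts i j <| by
    rwa [← map_add_atTop_eq_nat T] at hij

theorem eventually_forall_frequently_trusts [Finite V] (O : Set (EuclideanSpace ℝ (Fin d)))
    (ξ : ℕ → State V d) :
    ∀ᶠ t in atTop, ∀ i j, Trusts O (ξ t) i j → ∃ᶠ s in atTop, Trusts O (ξ s) i j := by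
  refine eventually_all.2 fun i => eventually_all.2 fun j => ?_
  by_cases h : ∃ᶠ t in atTop, Trusts O (ξ t) i j
  · exact .of_forall fun _ _ => h
  · exact (not_frequently.1 h).mono fun _ ht ht' => absurd ht' ht

theorem IsLimitState.eventually_trusts_iff [Finite V] (hlim : IsLimitState O ξ ξlim)
    (hO : O ∈ 𝓝 0) :
    ∀ᶠ t in atTop, ∀ i j, Trusts O (ξ t) i j ↔ ξlim i = ξlim j := by
  refine eventually_all.2 fun i => eventually_all.2 fun j => ?_
  by_cases hij : ξlim i = ξlim j
  · have hsub : Tendsto (fun t => ξ t j - ξ t i) atTop (𝓝 0) := by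
      simpa [hij] using (hlim.tendsto j).sub (hlim.tendsto i)
    exact (hsub.eventually_mem hO).mono fun t ht => iff_of_true ht hij
  · exact (not_frequently.1 (mt (hlim.eq_of_frequently_trusts i j) hij)).mono
      fun t ht => iff_of_false ht hij

variable [Fintype V]

theorem neighbors_of_mem (hi : i ∈ S) : neighbors O S X i = {i} := by
  simp [neighbors, hi]

theorem mem_neighbors_of_notMem (hi : i ∉ S) : j ∈ neighbors O S X i ↔ Trusts O X i j := by
  simp [neighbors, hi]

theorem self_mem_neighbors (hzero : 0 ∈ O) (X : State V d) (i : V) : i ∈ neighbors O S X i := by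
  by_cases hi : i ∈ S
  · simp [neighbors_of_mem hi]
  · exact (mem_neighbors_of_notMem hi).2 (trusts_of_eq hzero rfl)

theorem trusts_of_mem_neighbors (hzero : 0 ∈ O) (hj : j ∈ neighbors O S X i) :
    Trusts O X i j := by
  by_cases hi : i ∈ S
  · rw [neighbors_of_mem hi, Finset.mem_singleton] at hj
    exact trusts_of_eq hzero (congrArg X hj.symm)
  · exact (mem_neighbors_of_notMem hi).1 hj

theorem step_of_mem (hi : i ∈ S) : step O S X i = X i := by
  simp [step, neighbors_of_mem hi]

theorem step_eq_self (hzero : 0 ∈ O) (h : ∀ j ∈ neighbors O S X i, X j = X i) :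
    step O S X i = X i := by
  have hcard : ((neighbors O S X i).card : ℝ) ≠ 0 :=
    Nat.cast_ne_zero.2 (Finset.card_ne_zero_of_mem (self_mem_neighbors hzero X i))
  rw [step, Finset.sum_congr rfl h, Finset.sum_const, ← Nat.cast_smul_eq_nsmul ℝ,
    inv_smul_smul₀ hcard]

theorem IsClustered.isEquilibrium (hzero : 0 ∈ O) (hX : IsClustered O X) : IsEquilibrium O S X :=
  funext fun i => step_eq_self hzero fun j hj =>
    ((hX i j).resolve_right (not_not_intro (trusts_of_mem_neighbors hzero hj))).symm

theorem map_step_le (hstub : ∀ i ∈ S, X i = ξstar) (φ : EuclideanSpace ℝ (Fin d) →ₗ[ℝ] ℝ) {M : ℝ}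
    (hij : Listens O S X i j) (hM : ∀ k, Listens O S X i k → φ (X k) ≤ M) :
    φ (step O S X i) ≤ M - (Nat.card V : ℝ)⁻¹ * (M - φ (X j)) := by
  have hgap : 0 ≤ M - φ (X j) := sub_nonneg.2 (hM j hij)
  by_cases hi : i ∈ S
  · rw [step_of_mem hi, hstub i hi, ← hstub j (hij.2 hi)]
    linarith [mul_le_of_le_one_left hgap (Nat.cast_inv_le_one (α := ℝ) (Nat.card V))]
  · have hj : j ∈ neighbors O S X i := (mem_neighbors_of_notMem hi).2 hij.1
    have hcard : (neighbors O S X i).card ≤ Nat.card V := by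
      rw [Nat.card_eq_fintype_card]
      exact Finset.card_le_univ _
    have hpos : 0 < (neighbors O S X i).card := Finset.card_pos.2 ⟨j, hj⟩
    calc φ (step O S X i)
        = ((neighbors O S X i).card : ℝ)⁻¹ * ∑ k ∈ neighbors O S X i, φ (X k) := by
          rw [step, map_smul, map_sum, smul_eq_mul]
      _ ≤ M - ((neighbors O S X i).card : ℝ)⁻¹ * (M - φ (X j)) :=
          inv_card_mul_sum_le hj fun k hk =>
            hM k ⟨(mem_neighbors_of_notMem hi).1 hk, fun h => absurd h hi⟩
      _ ≤ M - (Nat.card V : ℝ)⁻¹ * (M - φ (X j)) := by gcongr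

namespace IsSolution

theorem eq_of_mem (hξ : IsSolution O S ξ) (hstub : ∀ i ∈ S, ξ 0 i = ξstar) (t : ℕ) :
    ∀ i ∈ S, ξ t i = ξstar := by
  intro i hi
  induction t with
  | zero => exact hstub i hi
  | succ t ih => rw [hξ t, step_of_mem hi, ih]

theorem isSubaveraging (hξ : IsSolution O S ξ) (hstub : ∀ i ∈ S, ξ 0 i = ξstar)
    (φ : EuclideanSpace ℝ (Fin d) →ₗ[ℝ] ℝ) :
    IsSubaveraging (Nat.card V : ℝ)⁻¹ (fun t => Listens O S (ξ t)) (fun t i => φ (ξ t i)) :=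
  fun t i _ _ hij hM =>
    (congrArg (fun X => φ (X i)) (hξ t)).trans_le (map_step_le (hξ.eq_of_mem hstub t) φ hij hM)

theorem exists_tendsto_map_component (hzero : 0 ∈ O) (hsymm : ∀ x, x ∈ O ↔ -x ∈ O)
    (hξ : IsSolution O S ξ) (hstub : ∀ i ∈ S, ξ 0 i = ξstar)
    (hrec : ∀ t i j, Trusts O (ξ t) i j → ∃ᶠ s in atTop, Trusts O (ξ s) i j)
    (C : (recurrentGraph O ξ).ConnectedComponent) (φ : EuclideanSpace ℝ (Fin d) →ₗ[ℝ] ℝ) :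
    ∃ L, ∀ i ∈ C, Tendsto (fun t => φ (ξ t i)) atTop (𝓝 L) := by
  obtain ⟨i₀, hroot⟩ : ∃ i₀ : C, ∀ i ∈ C, i ∈ S → (i₀ : V) ∈ S := by
    by_cases h : ∃ i ∈ C, i ∈ S
    · obtain ⟨i₀, hi₀, hi₀S⟩ := h
      exact ⟨⟨i₀, hi₀⟩, fun _ _ _ => hi₀S⟩
    · obtain ⟨i₀, hi₀⟩ := C.nonempty_supp
      exact ⟨⟨i₀, hi₀⟩, fun i hi hiS => absurd ⟨i, hi, hiS⟩ h⟩
  have hclosed : ∀ t, ∀ i ∈ C.supp, ∀ j, Listens O S (ξ t) i j → j ∈ C.supp :=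
    fun t i hi j hij =>
      (connectedComponentMk_eq_of_frequently_trusts (hrec t i j hij.1)).symm.trans hi
  have : Nonempty V := ⟨i₀⟩
  obtain ⟨L, hL⟩ :=
    (isRecurrentlyBalanced_listens hzero hsymm (hξ.eq_of_mem hstub) hroot).exists_tendsto
      (inv_pos.2 (Nat.cast_pos.2 Nat.card_pos)) (Nat.cast_inv_le_one _)
      ((hξ.isSubaveraging hstub φ).restrict hclosed)
      ((hξ.isSubaveraging hstub (-φ)).restrict hclosed)
  exact ⟨L, fun i hi => hL ⟨i, hi⟩⟩

theorem exists_isLimitState_of_recurrent (hzero : 0 ∈ O) (hsymm : ∀ x, x ∈ O ↔ -x ∈ O)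
    (hξ : IsSolution O S ξ) (hstub : ∀ i ∈ S, ξ 0 i = ξstar)
    (hrec : ∀ t i j, Trusts O (ξ t) i j → ∃ᶠ s in atTop, Trusts O (ξ s) i j) :
    ∃ ξlim, IsLimitState O ξ ξlim := by
  choose L hL using fun C (k : Fin d) =>
    hξ.exists_tendsto_map_component hzero hsymm hstub hrec C (EuclideanSpace.projₗ k)
  refine ⟨fun i => WithLp.toLp 2 (L ((recurrentGraph O ξ).connectedComponentMk i)),
    fun i => ?_, fun i j hij => ?_⟩
  · exact ((PiLp.continuous_toLp 2 _).tendsto _).comp (tendsto_pi_nhds.2 fun k => hL _ k i rfl)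
  · rw [connectedComponentMk_eq_of_frequently_trusts hij]

theorem exists_isLimitState (hzero : 0 ∈ O) (hsymm : ∀ x, x ∈ O ↔ -x ∈ O)
    (hξ : IsSolution O S ξ) (hstub : ∀ i ∈ S, ξ 0 i = ξstar) :
    ∃ ξlim, IsLimitState O ξ ξlim := by
  obtain ⟨T, hT⟩ := eventually_atTop.1 (eventually_forall_frequently_trusts O ξ)
  have hξT : IsSolution O S fun t => ξ (t + T) := fun t =>
    (congrArg ξ (Nat.add_right_comm t 1 T)).trans (hξ (t + T))
  have hrec : ∀ t i j, Trusts O (ξ (t + T)) i j →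
      ∃ᶠ s in atTop, Trusts O (ξ (s + T)) i j := fun t i j hij => by
    have hfreq := hT (t + T) (Nat.le_add_left T t) i j hij
    rwa [← map_add_atTop_eq_nat T] at hfreq
  obtain ⟨ξlim, hlim⟩ := hξT.exists_isLimitState_of_recurrent hzero hsymm
    (hξ.eq_of_mem hstub (0 + T)) hrec
  exact ⟨ξlim, hlim.of_add⟩

end IsSolution

theorem IsEquilibrium.isClustered (hzero : 0 ∈ O) (hsymm : ∀ x, x ∈ O ↔ -x ∈ O)
    (hX : IsEquilibrium O S X) (hstub : ∀ i ∈ S, X i = ξstar) : IsClustered O X := by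
  have hconst : IsSolution O S fun _ => X := fun _ => hX.symm
  obtain ⟨ξlim, hlim⟩ := hconst.exists_isLimitState hzero hsymm hstub
  obtain rfl : X = ξlim :=
    funext fun i => tendsto_nhds_unique tendsto_const_nhds (hlim.tendsto i)
  exact fun i j => or_iff_not_imp_right.2 fun hij =>
    hlim.eq_of_frequently_trusts i j (.of_forall fun _ => not_not.1 hij)

namespace IsLimitState

theorem eventually_mem_neighbors_iff (hlim : IsLimitState O ξ ξlim) (hO : O ∈ 𝓝 0) :
    ∀ᶠ t in atTop, ∀ i ∉ S, ∀ j, j ∈ neighbors O S (ξ t) i ↔ ξlim i = ξlim j :=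
  (hlim.eventually_trusts_iff hO).mono fun _ ht i hi j =>
    (mem_neighbors_of_notMem hi).trans (ht i j)

theorem eventually_eq_of_lim_eq (hlim : IsLimitState O ξ ξlim) (hξ : IsSolution O S ξ)
    (hO : O ∈ 𝓝 0) : ∀ᶠ t in atTop, ∀ i ∉ S, ∀ j ∉ S, ξlim i = ξlim j → ξ t i = ξ t j := by
  rw [← map_add_atTop_eq_nat 1, eventually_map]
  filter_upwards [hlim.eventually_mem_neighbors_iff hO] with t ht i hi j hj hij
  have hnb : neighbors O S (ξ t) i = neighbors O S (ξ t) j :=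
    Finset.ext fun k => by rw [ht i hi, ht j hj, hij]
  rw [hξ t, step, step, hnb]

theorem eventually_eq_lim (hlim : IsLimitState O ξ ξlim) (hξ : IsSolution O S ξ)
    (hO : O ∈ 𝓝 0) (hi : ∀ j ∈ S, ξlim j ≠ ξlim i) : ∀ᶠ t in atTop, ξ t i = ξlim i := by
  have hregular : ∀ j, ξlim i = ξlim j → j ∉ S := fun j hij hj => hi j hj hij.symm
  have hstationary : ∀ᶠ t in atTop, ξ (t + 1) i = ξ t i := by
    filter_upwards [hlim.eventually_mem_neighbors_iff hO, hlim.eventually_eq_of_lim_eq hξ hO]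
      with t hnb hmerged
    rw [hξ t]
    refine step_eq_self (mem_of_mem_nhds hO) fun j hj => ?_
    have hij : ξlim i = ξlim j := (hnb i (hregular i rfl) j).1 hj
    exact hmerged j (hregular j hij) i (hregular i rfl) hij.symm
  have hconst : EventuallyConst (fun t => ξ t i) atTop :=
    eventuallyConst_atTop_nat.2 (eventually_atTop.1 hstationary)
  obtain ⟨x, hx⟩ := eventuallyConst_iff_exists_eventuallyEq.1 hconst
  have hlim_eq : ξlim i = x :=
    tendsto_nhds_unique (hlim.tendsto i) (tendsto_const_nhds.congr' hx.symm)
  exact hx.mono fun t ht => ht.trans hlim_eq.symm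

theorem eq_of_mem (hlim : IsLimitState O ξ ξlim) (hξ : IsSolution O S ξ)
    (hstub : ∀ i ∈ S, ξ 0 i = ξstar) (hi : i ∈ S) : ξlim i = ξstar :=
  tendsto_nhds_unique (hlim.tendsto i)
    (tendsto_const_nhds.congr fun t => (hξ.eq_of_mem hstub t i hi).symm)

theorem exists_eventually_eq_lim (hlim : IsLimitState O ξ ξlim)
    (hξ : IsSolution O S ξ) (hstub : ∀ i ∈ S, ξ 0 i = ξstar) (hO : O ∈ 𝓝 0) (i : V) :
    ∃ j, ξlim j = ξlim i ∧ ∀ᶠ t in atTop, ξ t j = ξlim j := by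
  by_cases! hi : ∃ j ∈ S, ξlim j = ξlim i
  · obtain ⟨j, hj, hji⟩ := hi
    exact ⟨j, hji, .of_forall fun t =>
      (hξ.eq_of_mem hstub t j hj).trans (hlim.eq_of_mem hξ hstub hj).symm⟩
  · exact ⟨i, rfl, hlim.eventually_eq_lim hξ hO hi⟩

theorem isClustered (hlim : IsLimitState O ξ ξlim) (hξ : IsSolution O S ξ)
    (hstub : ∀ i ∈ S, ξ 0 i = ξstar) (hO : O ∈ 𝓝 0) : IsClustered O ξlim := by
  refine fun i j => or_iff_not_imp_right.2 fun hij => ?_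
  obtain ⟨i', hi', hti⟩ := hlim.exists_eventually_eq_lim hξ hstub hO i
  obtain ⟨j', hj', htj⟩ := hlim.exists_eventually_eq_lim hξ hstub hO j
  rw [← hi', ← hj']
  refine hlim.eq_of_frequently_trusts i' j' ((hti.and htj).frequently.mono fun t ht => ?_)
  rw [Trusts, ht.1, ht.2, hi', hj']
  exact not_not.1 hij

theorem exists_forall_ge_eq (hlim : IsLimitState O ξ ξlim)
    (hξ : IsSolution O ∅ ξ) (hO : O ∈ 𝓝 0) : ∃ T, ∀ t, T ≤ t → ξ t = ξ T := by
  have hev : ∀ᶠ t in atTop, ∀ i, ξ t i = ξlim i :=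
    eventually_all.2 fun i => hlim.eventually_eq_lim hξ hO (by simp)
  exact eventuallyConst_atTop.1
    (eventuallyConst_iff_exists_eventuallyEq.2 ⟨ξlim, hev.mono fun _ => funext⟩)

theorem tendsto_or_exists_forall_ge_eq (hlim : IsLimitState O ξ ξlim)
    (hξ : IsSolution O S ξ) (hstub : ∀ i ∈ S, ξ 0 i = ξstar) (hO : O ∈ 𝓝 0) (i : V) :
    Tendsto (fun t => ξ t i) atTop (𝓝 ξstar) ∨ ∃ T, ∀ t, T ≤ t → ξ t i = ξ T i := by
  by_cases! hi : ∃ j ∈ S, ξlim j = ξlim i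
  · obtain ⟨j, hj, hji⟩ := hi
    rw [← hlim.eq_of_mem hξ hstub hj, hji]
    exact .inl (hlim.tendsto i)
  · exact .inr (eventuallyConst_atTop.1
      (eventuallyConst_iff_exists_eventuallyEq.2
        ⟨ξlim i, hlim.eventually_eq_lim hξ hO hi⟩))

end IsLimitState

end Dynamics

end SCOD

theorem theorem1 {V : Type*} [Fintype V] {d : ℕ}
    (O : Set (EuclideanSpace ℝ (Fin d))) (S : Set V)
    (hzero : (0 : EuclideanSpace ℝ (Fin d)) ∈ O)
    (hsymm : ∀ x, x ∈ O ↔ -x ∈ O)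
    (ξ : ℕ → SCOD.State V d) (hξ : SCOD.IsSolution O S ξ)
    (ξstar : EuclideanSpace ℝ (Fin d)) (hstub : ∀ i ∈ S, ξ 0 i = ξstar) :
    -- (A)
    (SCOD.IsEquilibrium O S (ξ 0) ↔ SCOD.IsClustered O (ξ 0)) ∧
    ∃ ξlim : SCOD.State V d,
      -- (B)
      (∀ i, Tendsto (fun t => ξ t i) atTop (𝓝 (ξlim i))) ∧
      (∀ i j, (∃ᶠ t in atTop, SCOD.Trusts O (ξ t) i j) → ξlim i = ξlim j) ∧
      ((∃ R : ℝ, 0 < R ∧ Metric.ball 0 R ⊆ O) →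
        -- (C)
        (SCOD.IsEquilibrium O S ξlim ∧ SCOD.IsClustered O ξlim) ∧
        -- (D)
        (S = ∅ → ∃ T, ∀ t, T ≤ t → ξ t = ξ T) ∧
        (S.Nonempty → ∀ i,
          Tendsto (fun t => ξ t i) atTop (𝓝 ξstar) ∨ ∃ T, ∀ t, T ≤ t → ξ t i = ξ T i)) := by
  obtain ⟨ξlim, hlim⟩ := hξ.exists_isLimitState hzero hsymm hstub
  refine ⟨⟨fun h => h.isClustered hzero hsymm hstub, fun h => h.isEquilibrium hzero⟩,
    ξlim, hlim.tendsto, hlim.eq_of_frequently_trusts, ?_⟩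
  rintro ⟨R, hR, hRO⟩
  have hO : O ∈ 𝓝 0 := mem_of_superset (Metric.ball_mem_nhds 0 hR) hRO
  have hclustered := hlim.isClustered hξ hstub hO
  refine ⟨⟨hclustered.isEquilibrium hzero, hclustered⟩, ?_,
    fun _ => hlim.tendsto_or_exists_forall_ge_eq hξ hstub hO⟩
  rintro rfl
  exact hlim.exists_forall_ge_eq hξ hO
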